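/- Let $n\ge 1$, let $K\subseteq\mathbb R^n$ be a proper cone (a closed convex cone containing $0$, with $K\cap(-K)=\{0\}$ and nonempty interior), and let $\pi(K)$ be the set of real $n\times n$ matrices $A$ with $AK\subseteq K$. A face of a cone $C$ is a convex cone $F\subseteq C$ containing $0$ such that $x\in F$, $y\in C$ and $x-y\in C$ imply $y\in F$; for $S\subseteq C$, $\Phi(S)$ denotes the face of $C$ generated by $S$, i.e. the intersection of all faces of $C$ that include $S$. Let $K^*=\{z\in\mathbb R^n: z^Tx\ge 0 \text{ for all } x\in K\}$, and for a face $F$ of $K^*$ let $d_{K^*}(F)=(\operatorname{span}F)^\perp\cap K^{**}$, where $K^{**}=K$. Write $\mathcal N(\cdot)$ for the null space in $\mathbb R^n$, $\rho(A)$ for the spectral radius of $A$, and $\nu_{\rho(A)}(A)$ for the least integer $k\ge 0$ with $\mathcal N((A-\rho(A)I)^k)=\mathcal N((A-\rho(A)I)^{k+1})$. For $0\ne x\in\mathbb R^n$ write $x=x_1+\cdots+x_k$ with $x_i\in\mathbb C^n$ (nonzero) generalized eigenvectors of $A$ for distinct eigenvalues $\lambda_1,\dots,\lambda_k$. Put $\rho_x(A)=\max_i|\lambda_i|$,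 and let $\mathrm{ord}_A(x)$ be the maximum, over those $i$ with $|\lambda_i|=\rho_x(A)$, of the least positive integer $p$ with $(A-\lambda_iI)^px_i=0$; for $x=0$ put $\rho_x(A)=0$ and $\mathrm{ord}_A(x)=0$. The spectral pair of $x$ is $\mathrm{sp}_A(x)=(\rho_x(A),\mathrm{ord}_A(x))$, and $\preceq$ is the lexicographic order on $\mathbb R^2$: $(\xi_1,\xi_2)\preceq(\eta_1,\eta_2)$ if $\xi_1<\eta_1$, or $\xi_1=\eta_1$ and $\xi_2\le\eta_2$. Then for every $A\in\pi(K)$, $$\begin{aligned} &\Phi\big((A-\rho(A)I)K\cap K\big)\\ &=\Phi\big(K\cap (A-\rho(A)I)\,\Phi(\mathcal N((\rho(A)I-A)^n)\cap K)\big)\\ &\subseteq \Phi\big(\mathcal N((\rho(A)I-A)^n)\cap K\big)\cap d_{K^*}\big(\Phi(\mathcal N(\rho(A)I-A^T)\cap K^*)\big)\\ &\subseteq \Phi\big(\mathcal N((\rho(A)I-A)^n)\cap K\big)\cap\{y\in K:\ \mathrm{sp}_A(y)\preceq(\rho(A),\nu_{\rho(A)}(A)-1)\}. \end{aligned}$$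 Here $\Phi(\mathcal N(\rho(A)I-A^T)\cap K^*)$ is the face generated in $K^*$; all other $\Phi$ are taken in $K$. -/

import Mathlib

open Matrix

noncomputable section

namespace ConeEquations

/-- A convex cone in `ℝⁿ` containing `0` (Mathlib's `PointedCone`) is *proper* if it is closed,
satisfies `K ∩ (-K) = {0}`, and has nonempty interior. -/
structure IsProperCone {n : ℕ} (K : PointedCone ℝ (Fin n → ℝ)) : Prop where
  isClosed : IsClosed (K : Set (Fin n → ℝ))
  eq_zero_of_neg_mem : ∀ x ∈ K, -x ∈ K → x = 0
  interior_nonempty : (interior (K : Set (Fin n → ℝ))).Nonempty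

/-- The set `π(K)` of real matrices `A` with `A K ⊆ K`. -/
def positiveMaps {n : ℕ} (K : PointedCone ℝ (Fin n → ℝ)) : Set (Matrix (Fin n) (Fin n) ℝ) :=
  {A | ∀ x ∈ K, A *ᵥ x ∈ K}

/-- `Φ(S)`, the face of `K` generated by `S`: the intersection of all faces of `K` including `S`.
For a face `F` of `K` (Mathlib's `PointedCone.IsFaceOf`) and `x, y` in `K`, the relation
`x + y ∈ F` forces `x ∈ F`. -/
def faceGenerated {n : ℕ} (K : PointedCone ℝ (Fin n → ℝ)) (S : Set (Fin n → ℝ)) :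
    PointedCone ℝ (Fin n → ℝ) :=
  sInf {F | F.IsFaceOf K ∧ S ⊆ (F : Set (Fin n → ℝ))}

/-- The dual cone `K* = {z | zᵀ x ≥ 0 for all x ∈ K}`. -/
def dualCone {n : ℕ} (K : PointedCone ℝ (Fin n → ℝ)) : PointedCone ℝ (Fin n → ℝ) :=
  PointedCone.dual (dotProductBilin ℝ ℝ) (K : Set (Fin n → ℝ))

/-- The duality operator `d_K(F) = (span F)^⊥ ∩ K*`. -/
def dualFace {n : ℕ} (K F : PointedCone ℝ (Fin n → ℝ)) : Set (Fin n → ℝ) :=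
  {z | (∀ x ∈ Submodule.span ℝ (F : Set (Fin n → ℝ)), x ⬝ᵥ z = 0) ∧ z ∈ dualCone K}

/-- A real matrix regarded as a complex matrix. -/
def complexify {n : ℕ} (A : Matrix (Fin n) (Fin n) ℝ) : Matrix (Fin n) (Fin n) ℂ :=
  A.map Complex.ofReal

/-- The null space of a real matrix, in `ℝⁿ`. -/
def nullSpace {n : ℕ} (A : Matrix (Fin n) (Fin n) ℝ) : Submodule ℝ (Fin n → ℝ) :=
  LinearMap.ker (Matrix.toLin' A)

/-- The spectral radius `ρ(A)` of a real matrix: the largest modulus of its complex eigenvalues. -/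
def rho {n : ℕ} (A : Matrix (Fin n) (Fin n) ℝ) : ℝ :=
  (spectralRadius ℂ (complexify A)).toReal

/-- The index `ν_μ(A)` of `μ`: the least `k ≥ 0` with
`N((A - μ I)^k) = N((A - μ I)^(k+1))`. -/
def eigenvalueIndex {n : ℕ} (A : Matrix (Fin n) (Fin n) ℝ) (μ : ℝ) : ℕ :=
  sInf {k | nullSpace ((A - μ • (1 : Matrix (Fin n) (Fin n) ℝ)) ^ k) =
    nullSpace ((A - μ • (1 : Matrix (Fin n) (Fin n) ℝ)) ^ (k + 1))}

/-- `f` represents `x` as a sum of generalized eigenvectors of `A` for distinct eigenvalues: `f μ`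
is the term for `μ`, and it is `0` for all but finitely many `μ` (in particular whenever `μ` is not
an eigenvalue of `A`). -/
def IsGenEigenDecomposition {n : ℕ} (A : Matrix (Fin n) (Fin n) ℂ) (x : Fin n → ℂ)
    (f : ℂ →₀ (Fin n → ℂ)) : Prop :=
  (∀ μ, f μ ∈ Module.End.maxGenEigenspace (Matrix.toLin' A) μ) ∧ (f.sum fun _ v => v) = x

theorem existsUnique_genEigenDecomposition {n : ℕ} (A : Matrix (Fin n) (Fin n) ℂ)
    (x : Fin n → ℂ) : ∃! f, IsGenEigenDecomposition A x f := by
  have hx : x ∈ ⨆ μ, Module.End.maxGenEigenspace (Matrix.toLin' A) μ := by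
    rw [Module.End.iSup_maxGenEigenspace_eq_top]; trivial
  obtain ⟨f, hf, hfx⟩ := (Submodule.mem_iSup_iff_exists_finsupp _ _).1 hx
  refine ⟨f, ⟨hf, hfx⟩, fun g hg => ?_⟩
  have hind := Module.End.independent_maxGenEigenspace (Matrix.toLin' A)
  rw [iSupIndep_iff_finsetSum_eq_imp_eq] at hind
  classical
  have hsum : ∑ μ ∈ g.support ∪ f.support, g μ = ∑ μ ∈ g.support ∪ f.support, f μ := by
    have h1 := Finsupp.sum_of_support_subset g (Finset.subset_union_left (s₂ := f.support))
      (fun _ v => v) (fun _ _ => rfl)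
    have h2 := Finsupp.sum_of_support_subset f (Finset.subset_union_right (s₁ := g.support))
      (fun _ v => v) (fun _ _ => rfl)
    rw [← h1, ← h2, hg.2, hfx]
  ext1 μ
  by_cases hμ : μ ∈ g.support ∪ f.support
  · exact hind _ _ _ (fun i _ => ⟨hg.1 i, hf i⟩) hsum μ hμ
  · simp only [Finset.mem_union, Finsupp.mem_support_iff, not_or, not_not] at hμ
    rw [hμ.1, hμ.2]

/-- The representation of `x` as a sum of generalized eigenvectors of `A` for distinct
eigenvalues. -/
def genEigenComponents {n : ℕ} (A : Matrix (Fin n) (Fin n) ℂ) (x : Fin n → ℂ) :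
    ℂ →₀ (Fin n → ℂ) :=
  (existsUnique_genEigenDecomposition A x).choose

/-- The local spectral radius `ρ_x(A)`: the largest `|μ|` over the eigenvalues `μ` whose term in
the representation of `x` as a sum of generalized eigenvectors is nonzero (`0` if `x = 0`). -/
def localSpectralRadius {n : ℕ} (A : Matrix (Fin n) (Fin n) ℂ) (x : Fin n → ℂ) : ℝ :=
  (((genEigenComponents A x).support.sup fun μ => ‖μ‖₊ : NNReal) : ℝ)

/-- The order of a generalized eigenvector `v` for `μ`: the least `p ≥ 1` with
`(A - μ I)^p v = 0`. -/
def genEigenOrder {n : ℕ} (A : Matrix (Fin n) (Fin n) ℂ) (μ : ℂ) (v : Fin n → ℂ) : ℕ :=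
  sInf {p | 1 ≤ p ∧ ((A - μ • (1 : Matrix (Fin n) (Fin n) ℂ)) ^ p) *ᵥ v = 0}

/-- The order `ord_A(x)`: the largest order of the nonzero terms, for eigenvalues of modulus
`ρ_x(A)`, in the representation of `x` as a sum of generalized eigenvectors (`0` if `x = 0`). -/
def vectorOrder {n : ℕ} (A : Matrix (Fin n) (Fin n) ℂ) (x : Fin n → ℂ) : ℕ :=
  ((genEigenComponents A x).support.filter fun μ => ‖μ‖ = localSpectralRadius A x).sup
    fun μ => genEigenOrder A μ (genEigenComponents A x μ)

/-- The spectral pair `sp_A(x) = (ρ_x(A), ord_A(x))` of a real vector relative to a real matrix, in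
`ℝ × ℝ` with the lexicographic order. -/
def spectralPair {n : ℕ} (A : Matrix (Fin n) (Fin n) ℝ) (x : Fin n → ℝ) : ℝ ×ₗ ℝ :=
  toLex (localSpectralRadius (complexify A) (fun i => (x i : ℂ)),
    (vectorOrder (complexify A) (fun i => (x i : ℂ)) : ℝ))

/-- The image `(A - ρ(A) I) S` of a set `S`. -/
def shiftImage {n : ℕ} (A : Matrix (Fin n) (Fin n) ℝ) (S : Set (Fin n → ℝ)) : Set (Fin n → ℝ) :=
  (fun x => (A - rho A • (1 : Matrix (Fin n) (Fin n) ℝ)) *ᵥ x) '' S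

/-- The face `Φ(N((ρ(A) I - A)^n) ∩ K)` generated by the generalized eigenvectors of `A` for `ρ(A)`
that lie in `K`. -/
def genEigenFace {n : ℕ} (K : PointedCone ℝ (Fin n → ℝ)) (A : Matrix (Fin n) (Fin n) ℝ) :
    PointedCone ℝ (Fin n → ℝ) :=
  faceGenerated K
    ((nullSpace ((rho A • (1 : Matrix (Fin n) (Fin n) ℝ) - A) ^ n) : Set (Fin n → ℝ)) ∩ K)

/-- The face `Φ(N(ρ(A) I - Aᵀ) ∩ K*)` of `K*`. -/
def dualEigenFace {n : ℕ} (K : PointedCone ℝ (Fin n → ℝ)) (A : Matrix (Fin n) (Fin n) ℝ) :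
    PointedCone ℝ (Fin n → ℝ) :=
  faceGenerated (dualCone K)
    ((nullSpace (rho A • (1 : Matrix (Fin n) (Fin n) ℝ) - Aᵀ) : Set (Fin n → ℝ)) ∩ dualCone K)

end ConeEquations

end

open ConeEquations

/-! Write `ρ` for `rho A`, `E` for the spectral projection at `ρ`, `R(s) = (s - A)⁻¹`. For `s > ρ`
the Neumann series shows that `R(s)` maps `K` into `K`; everything is read off from `R(s)` as `s`
decreases to `ρ`.

Equality: the generating sets themselves coincide (`shiftImage_inter_eq`). If `x` and `y = (A - ρ)x`
lie in `K`, then `w(s) = R(s)y = (s - ρ)R(s)x - x` lies in `K`, and the part of `x + w(s)` outside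
the generalized eigenspace of `ρ` tends to `0`. That part is a combination of the vectors `(1 -
E)A^k y`, `k < n`, with small coefficients, while `w(s)` contains the terms `A^k y` with
coefficients bounded below. Correcting `w(s)` by a small combination of the `A^k y` keeps it in `K`
and makes `x + w` a generalized eigenvector in `K`, so `x` lies in the face that these generate
(`exists_add_mem_nullSpace`).

First inclusion: that face is `A`-invariant, and nonnegative eigenvectors of `Aᵀ` for `ρ` annihilate
the range of `A - ρ`; both facts pass to generated faces.

Second inclusion: with `ν` the index of `ρ`, `P = (A - ρ)^(ν-1) E` is the limit of `(s - ρ)^ν R(s)`,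
so `P` preserves `K`, and `Pᵀ` sends `K*` to eigenvectors of `Aᵀ` in `K*`. Orthogonality to those
gives `Py = 0` (`pow_pred_index_mulVec_eq_zero`). Other eigenvalues of modulus `ρ` are controlled by
`|z·R(sθ)y| ≤ z·R(s)y` for `|θ| = 1`, which bounds pole orders (`peripheral_pow_mulVec_eq_zero`) and
also yields Perron–Frobenius. -/

namespace ConeEquations

/-! ### Spectral projections by polynomial algebra -/

section Splitting

variable {𝕜 : Type*} [Field 𝕜] {n : ℕ}

/-- `E` is the spectral projection of `A` onto the generalized eigenspace of `μ`, and `J` inverts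
`μ - A` on the complementary invariant subspace. -/
structure IsSpectralSplitting (A : Matrix (Fin n) (Fin n) 𝕜) (μ : 𝕜)
    (E J : Matrix (Fin n) (Fin n) 𝕜) : Prop where
  comm : Commute E A
  idem : E * E = E
  pow_mul : (A - μ • 1) ^ n * E = 0
  inv_mul : J * (μ • 1 - A) = 1 - E
  comm_inv : Commute J A

theorem exists_isSpectralSplitting (A : Matrix (Fin n) (Fin n) 𝕜) (μ : 𝕜) :
    ∃ E J, IsSpectralSplitting A μ E J := by
  classical
  obtain ⟨g, hg, hdvd⟩ := Polynomial.exists_eq_pow_rootMultiplicity_mul_and_not_dvd A.charpoly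
    A.charpoly_monic.ne_zero μ
  set k := A.charpoly.rootMultiplicity μ with hk
  have hkn : k ≤ n := by
    have h1 : (Polynomial.X - Polynomial.C μ) ^ k ∣ A.charpoly := ⟨g, hg⟩
    have h2 := Polynomial.natDegree_le_of_dvd h1 A.charpoly_monic.ne_zero
    simpa [Polynomial.natDegree_pow, Matrix.charpoly_natDegree_eq_dim] using h2
  -- Exponent `n + 1`: one factor of `A - μ` is split off to give `J * (μ - A) = 1 - E`, and the
  -- other `n` stay in `J`.
  have hcop : IsCoprime ((Polynomial.X - Polynomial.C μ) ^ (n + 1)) g := by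
    apply IsCoprime.pow_left
    exact (Polynomial.irreducible_X_sub_C μ).coprime_iff_not_dvd.2 hdvd
  obtain ⟨a, b, hab⟩ := hcop
  have hX : Polynomial.aeval A (Polynomial.X - Polynomial.C μ) = A - μ • 1 := by
    simp [Algebra.algebraMap_eq_smul_one]
  have hCH : (A - μ • 1) ^ n * Polynomial.aeval A g = 0 := by
    have h := A.aeval_self_charpoly
    rw [hg, map_mul, map_pow, hX] at h
    rw [← pow_sub_mul_pow _ hkn, mul_assoc, h, mul_zero]
  have hpoly : ∀ p q : Polynomial 𝕜, Polynomial.aeval A p * Polynomial.aeval A q =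
      Polynomial.aeval A q * Polynomial.aeval A p := fun p q => by
    rw [← map_mul, mul_comm, map_mul]
  have hcomm : ∀ p : Polynomial 𝕜, Commute (Polynomial.aeval A p) A := fun p => by
    have := hpoly p Polynomial.X
    rwa [Polynomial.aeval_X] at this
  have hone : Polynomial.aeval A a * (A - μ • 1) ^ (n + 1) +
      Polynomial.aeval A (b * g) = 1 := by
    have := congrArg (Polynomial.aeval A) hab
    rw [map_add, map_mul, map_pow, hX, map_one] at this
    exact this
  have hE : (A - μ • 1) ^ n * Polynomial.aeval A (b * g) = 0 := by
    rw [map_mul, hpoly b g, ← mul_assoc, hCH, zero_mul]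
  refine ⟨Polynomial.aeval A (b * g),
    - (Polynomial.aeval A (a * (Polynomial.X - Polynomial.C μ) ^ n)), hcomm _, ?_, hE, ?_, ?_⟩
  · have h : (1 - Polynomial.aeval A (b * g)) * Polynomial.aeval A (b * g) = 0 := by
      rw [← hone, add_sub_cancel_right, pow_succ', mul_assoc, mul_assoc, hE, mul_zero, mul_zero]
    rwa [sub_mul, one_mul, sub_eq_zero, eq_comm] at h
  · rw [← eq_sub_of_add_eq hone, map_mul, map_pow, hX, pow_succ, ← neg_sub A, neg_mul_neg,
      mul_assoc]
  · exact (hcomm _).neg_left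

namespace IsSpectralSplitting

variable {A E J : Matrix (Fin n) (Fin n) 𝕜} {μ : 𝕜}

theorem commute_sub (h : IsSpectralSplitting A μ E J) (ν : 𝕜) : Commute E (A - ν • 1) :=
  h.comm.sub_right ((Commute.one_right E).smul_right ν)

theorem mulVec_eq_self (h : IsSpectralSplitting A μ E J) {x : Fin n → 𝕜} {k : ℕ}
    (hx : (A - μ • 1) ^ k *ᵥ x = 0) : E *ᵥ x = x := by
  have hcomp : (1 - E) * (1 - E) = 1 - E := by
    simp [sub_mul, mul_sub, h.idem]
  have hkill : ∀ j : ℕ, (1 - E) * (J * (μ • 1 - A)) ^ j = 1 - E := by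
    intro j
    induction j with
    | zero => simp
    | succ j ih => rw [pow_succ, ← mul_assoc, ih, h.inv_mul, hcomp]
  have hJ : Commute J (μ • 1 - A) :=
    ((Commute.one_right J).smul_right μ).sub_right h.comm_inv
  have h0 : (μ • 1 - A) ^ k *ᵥ x = 0 := by
    rw [← neg_sub, neg_pow, ← mulVec_mulVec, hx, mulVec_zero]
  have h1 : (1 - E) *ᵥ x = 0 := by
    rw [← hkill k, hJ.mul_pow, ← mulVec_mulVec, ← mulVec_mulVec, h0, mulVec_zero, mulVec_zero]
  rwa [sub_mulVec, one_mulVec, sub_eq_zero, eq_comm] at h1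

/-- `E x` is annihilated by powers of both `A - μ` and `A - ν`, which are coprime polynomials in
`A`. -/
theorem mulVec_eq_zero_of_ne (h : IsSpectralSplitting A μ E J) {x : Fin n → 𝕜} {ν : 𝕜}
    (hν : ν ≠ μ) {k : ℕ} (hx : (A - ν • 1) ^ k *ᵥ x = 0) : E *ᵥ x = 0 := by
  have hcop : IsCoprime ((Polynomial.X - Polynomial.C μ) ^ n)
      ((Polynomial.X - Polynomial.C ν) ^ k) :=
    (Polynomial.isCoprime_X_sub_C_of_isUnit_sub (sub_ne_zero.2 hν.symm).isUnit).pow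
  obtain ⟨a, b, hab⟩ := hcop
  have hX : ∀ c : 𝕜, Polynomial.aeval A (Polynomial.X - Polynomial.C c) = A - c • 1 := fun c => by
    simp [Algebra.algebraMap_eq_smul_one]
  have h1 := congrArg (Polynomial.aeval A) hab
  rw [map_add, map_mul, map_mul, map_pow, map_pow, hX, hX, map_one] at h1
  have h2 : (A - μ • 1) ^ n *ᵥ (E *ᵥ x) = 0 := by
    rw [mulVec_mulVec, h.pow_mul, zero_mulVec]
  have h3 : (A - ν • 1) ^ k *ᵥ (E *ᵥ x) = 0 := by
    rw [mulVec_mulVec, ← ((h.commute_sub ν).pow_right k).eq, ← mulVec_mulVec, hx, mulVec_zero]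
  rw [← one_mulVec (E *ᵥ x), ← h1, add_mulVec, ← mulVec_mulVec, h2, ← mulVec_mulVec, h3]
  simp

theorem mulVec_resolvent (h : IsSpectralSplitting A μ E J) {c : 𝕜} {w y : Fin n → 𝕜}
    (hw : (c • 1 - A) *ᵥ w = y) : (c • 1 - A) *ᵥ (E *ᵥ w) = E *ᵥ y := by
  have hc : Commute E (c • 1 - A) := ((Commute.one_right E).smul_right c).sub_right h.comm
  rw [mulVec_mulVec, ← hc.eq, ← mulVec_mulVec, hw]

/-- The principal part of the resolvent at `μ`, multiplied by the `p`-th power of the distance. -/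
theorem pow_smul_mulVec (h : IsSpectralSplitting A μ E J) {c : 𝕜} {w y : Fin n → 𝕜}
    (hcμ : c ≠ μ) (hw : (c • 1 - A) *ᵥ w = y) {p : ℕ}
    (hp : (A - μ • 1) ^ p *ᵥ (E *ᵥ y) = 0) :
    (c - μ) ^ p • (E *ᵥ w) =
      ∑ j ∈ Finset.range p, (c - μ) ^ (p - 1 - j) • ((A - μ • 1) ^ j *ᵥ (E *ᵥ y)) := by
  have hEw := h.mulVec_resolvent hw
  set N := A - μ • (1 : Matrix (Fin n) (Fin n) 𝕜) with hN
  have hc : c • (1 : Matrix (Fin n) (Fin n) 𝕜) - A = (c - μ) • 1 - N := by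
    rw [hN, sub_smul]; abel
  have hcomm : Commute N ((c - μ) • (1 : Matrix (Fin n) (Fin n) 𝕜)) :=
    (Commute.one_right N).smul_right _
  have hgeom := hcomm.geom_sum₂_mul p
  have hNE : ∀ j, N ^ j * E = E * N ^ j := fun j => ((h.commute_sub μ).pow_right j).eq.symm
  -- No assumption keeps `c` off the spectrum. The vector `N ^ p *ᵥ (E *ᵥ w)` is killed by `c - A`,
  -- hence by `E`, yet it is fixed by `E`.
  have hNw : N ^ p *ᵥ (E *ᵥ w) = 0 := by
    have h1 : (c • 1 - A) *ᵥ (N ^ p *ᵥ (E *ᵥ w)) = 0 := by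
      have hcN : Commute (c • 1 - A) (N ^ p) := by
        rw [hc]
        exact (((Commute.one_left N).smul_left _).sub_left (Commute.refl N)).pow_right p
      rw [mulVec_mulVec, hcN.eq, ← mulVec_mulVec, hEw, hp]
    have h2 : (A - c • 1) ^ 1 *ᵥ (N ^ p *ᵥ (E *ᵥ w)) = 0 := by
      rw [pow_one, ← neg_sub, neg_mulVec, h1, neg_zero]
    have h3 := h.mulVec_eq_zero_of_ne hcμ h2
    rwa [mulVec_mulVec, mulVec_mulVec, ← hNE, mul_assoc, h.idem, hNE, ← hNE,
      ← mulVec_mulVec] at h3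
  have key : (∑ i ∈ Finset.range p, N ^ i * ((c - μ) • (1 : Matrix (Fin n) (Fin n) 𝕜)) ^ (p - 1 - i))
      *ᵥ (E *ᵥ y) = (c - μ) ^ p • (E *ᵥ w) := by
    rw [← hEw, hc, mulVec_mulVec, ← neg_sub N, mul_neg, hgeom, neg_sub, sub_mulVec, hNw, sub_zero,
      smul_pow, one_pow, smul_mulVec, one_mulVec]
  rw [← key, sum_mulVec]
  refine Finset.sum_congr rfl fun j _ => ?_
  rw [smul_pow, one_pow, mul_smul_comm, mul_one, smul_mulVec]

end IsSpectralSplitting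
end Splitting

/-! ### Poles and Neumann series of the resolvent -/

section Resolvent
open Filter Topology

attribute [local instance] Matrix.linftyOpNormedRing Matrix.linftyOpNormedAlgebra

variable {𝕜 : Type*} [RCLike 𝕜] {n : ℕ}

theorem IsSpectralSplitting.tendsto_pow_smul_mulVec {A E J : Matrix (Fin n) (Fin n) 𝕜} {μ : 𝕜}
    (h : IsSpectralSplitting A μ E J) {ι : Type*} {l : Filter ι} {c : ι → 𝕜}
    {w : ι → Fin n → 𝕜} {y : Fin n → 𝕜} (hc : Tendsto c l (𝓝[≠] μ))
    (hw : ∀ᶠ i in l, (c i • 1 - A) *ᵥ w i = y) {p : ℕ} (hp : 1 ≤ p)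
    (hy : (A - μ • 1) ^ p *ᵥ (E *ᵥ y) = 0) :
    Tendsto (fun i => (c i - μ) ^ p • (E *ᵥ w i)) l
      (𝓝 ((A - μ • 1) ^ (p - 1) *ᵥ (E *ᵥ y))) := by
  have ht : Tendsto (fun i => c i - μ) l (𝓝 0) := by
    simpa using (tendsto_nhdsWithin_iff.1 hc).1.sub_const μ
  have h1 : (fun i => ∑ j ∈ Finset.range p, (c i - μ) ^ (p - 1 - j) •
      ((A - μ • 1) ^ j *ᵥ (E *ᵥ y))) =ᶠ[l] fun i => (c i - μ) ^ p • (E *ᵥ w i) := by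
    filter_upwards [hw, (tendsto_nhdsWithin_iff.1 hc).2] with i hi hi'
    exact (h.pow_smul_mulVec hi' hi hy).symm
  refine Tendsto.congr' h1 ?_
  have h2 : Tendsto (fun i => ∑ j ∈ Finset.range p, (c i - μ) ^ (p - 1 - j) •
      ((A - μ • 1) ^ j *ᵥ (E *ᵥ y))) l (𝓝 (∑ j ∈ Finset.range p, (0 : 𝕜) ^ (p - 1 - j) •
      ((A - μ • 1) ^ j *ᵥ (E *ᵥ y)))) :=
    tendsto_finsetSum _ fun j _ => (ht.pow _).smul_const _
  convert h2
  -- Only `j = p - 1` carries the exponent `0`, so only it survives the limit.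
  rw [Finset.sum_eq_single (p - 1)]
  · simp
  · intro j hj hjp
    have := Finset.mem_range.1 hj
    rw [zero_pow (by omega), zero_smul]
  · intro h
    exact absurd (Finset.mem_range.2 (by omega)) h

/-- The resolvent stays bounded off the generalized eigenspace: `(1 - E)w` equals `J(1 - E)y` up to
an error `(c - μ)J(1 - E)w`, which is absorbed once `‖c - μ‖ * ‖J‖ ≤ 1/2`. -/
theorem IsSpectralSplitting.tendsto_sub_smul_compl {A E J : Matrix (Fin n) (Fin n) 𝕜} {μ : 𝕜}
    (h : IsSpectralSplitting A μ E J) {ι : Type*} {l : Filter ι} {c : ι → 𝕜}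
    {w : ι → Fin n → 𝕜} {y : Fin n → 𝕜} (hc : Tendsto c l (𝓝 μ))
    (hw : ∀ᶠ i in l, (c i • 1 - A) *ᵥ w i = y) :
    Tendsto (fun i => (c i - μ) • ((1 - E) *ᵥ w i)) l (𝓝 0) := by
  have ht : Tendsto (fun i => c i - μ) l (𝓝 0) := by simpa using hc.sub_const μ
  have hcomp : (1 - E) * (1 - E) = 1 - E := by
    simp [sub_mul, mul_sub, h.idem]
  have hsmall : ∀ᶠ i in l, ‖c i - μ‖ * ‖J‖ ≤ 1 / 2 := by
    have : Tendsto (fun i => ‖c i - μ‖ * ‖J‖) l (𝓝 0) := by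
      simpa using ht.norm.mul_const ‖J‖
    exact this.eventually_le_const (by norm_num)
  have hbdd : ∀ᶠ i in l, ‖(1 - E) *ᵥ w i‖ ≤ 2 * ‖J *ᵥ ((1 - E) *ᵥ y)‖ := by
    filter_upwards [hw, hsmall] with i hi hs
    have hcE : Commute (1 - E) (c i • 1 - A) :=
      (Commute.one_left _).sub_left (((Commute.one_right E).smul_right _).sub_right h.comm)
    have hdec : c i • (1 : Matrix (Fin n) (Fin n) 𝕜) - A = (μ • 1 - A) + (c i - μ) • 1 := by
      rw [sub_smul]; abel
    have h1 : J *ᵥ ((1 - E) *ᵥ y) =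
        (1 - E) *ᵥ w i + (c i - μ) • (J *ᵥ ((1 - E) *ᵥ w i)) := by
      rw [← hi, mulVec_mulVec _ (1 - E), hcE.eq, hdec, mulVec_mulVec, ← mul_assoc, mul_add,
        h.inv_mul, mul_smul_comm, mul_one, add_mul, hcomp, smul_mul_assoc, add_mulVec, smul_mulVec,
        mulVec_mulVec]
    have h2 : ‖(1 - E) *ᵥ w i‖ ≤ ‖J *ᵥ ((1 - E) *ᵥ y)‖ +
        ‖(c i - μ) • (J *ᵥ ((1 - E) *ᵥ w i))‖ := by
      have h4 := norm_sub_le (J *ᵥ ((1 - E) *ᵥ y)) ((c i - μ) • (J *ᵥ ((1 - E) *ᵥ w i)))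
      rwa [← eq_sub_of_add_eq h1.symm] at h4
    have h3 : ‖(c i - μ) • (J *ᵥ ((1 - E) *ᵥ w i))‖ ≤ 1 / 2 * ‖(1 - E) *ᵥ w i‖ := by
      rw [norm_smul]
      calc ‖c i - μ‖ * ‖J *ᵥ ((1 - E) *ᵥ w i)‖ ≤ ‖c i - μ‖ * (‖J‖ * ‖(1 - E) *ᵥ w i‖) := by
            gcongr; exact Matrix.linfty_opNorm_mulVec _ _
        _ = ‖c i - μ‖ * ‖J‖ * ‖(1 - E) *ᵥ w i‖ := by ring
        _ ≤ _ := by gcongr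
    linarith
  refine squeeze_zero_norm' (a := fun i => ‖c i - μ‖ * (2 * ‖J *ᵥ ((1 - E) *ᵥ y)‖)) ?_ ?_
  · filter_upwards [hbdd] with i hi
    rw [norm_smul]
    gcongr
  · simpa using ht.norm.mul_const _

/-- Extracts the coefficient of the pole of order `p`. Since `p ≥ 1`, the bounded complementary part
disappears. -/
theorem IsSpectralSplitting.tendsto_pow_smul {A E J : Matrix (Fin n) (Fin n) 𝕜} {μ : 𝕜}
    (h : IsSpectralSplitting A μ E J) {ι : Type*} {l : Filter ι} {c : ι → 𝕜}
    {w : ι → Fin n → 𝕜} {y : Fin n → 𝕜} (hc : Tendsto c l (𝓝[≠] μ))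
    (hw : ∀ᶠ i in l, (c i • 1 - A) *ᵥ w i = y) {p : ℕ} (hp : 1 ≤ p)
    (hy : (A - μ • 1) ^ p *ᵥ (E *ᵥ y) = 0) :
    Tendsto (fun i => (c i - μ) ^ p • w i) l
      (𝓝 ((A - μ • 1) ^ (p - 1) *ᵥ (E *ᵥ y))) := by
  have hc' := (tendsto_nhdsWithin_iff.1 hc).1
  have ht : Tendsto (fun i => c i - μ) l (𝓝 0) := by simpa using hc'.sub_const μ
  have h1 := h.tendsto_pow_smul_mulVec hc hw hp hy
  have h2 := (ht.pow (p - 1)).smul (h.tendsto_sub_smul_compl hc' hw)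
  have h3 := h1.add h2
  rw [smul_zero, add_zero] at h3
  refine h3.congr fun i => ?_
  rw [smul_smul, ← pow_succ, Nat.sub_add_cancel hp, ← smul_add, ← add_mulVec,
    add_sub_cancel, one_mulVec]

/-- The Neumann series of the resolvent, applied to a vector. -/
theorem exists_hasSum_resolvent (A : Matrix (Fin n) (Fin n) 𝕜) {c : 𝕜} (hc : c ≠ 0)
    (hs : Summable fun k : ℕ => ‖A ^ k‖ / ‖c‖ ^ (k + 1)) (v : Fin n → 𝕜) :
    ∃ w, (c • 1 - A) *ᵥ w = v ∧
      HasSum (fun k : ℕ => (c ^ (k + 1))⁻¹ • (A ^ k *ᵥ v)) w := by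
  have hsum : Summable fun k : ℕ => (c ^ (k + 1))⁻¹ • A ^ k := by
    refine Summable.of_norm (hs.congr fun k => ?_)
    rw [norm_smul, norm_inv, norm_pow c, div_eq_inv_mul]
  have hv : HasSum (fun k : ℕ => (c ^ (k + 1))⁻¹ • (A ^ k *ᵥ v))
      ((∑' k : ℕ, (c ^ (k + 1))⁻¹ • A ^ k) *ᵥ v) := by
    have hcont : Continuous fun M : Matrix (Fin n) (Fin n) 𝕜 => M *ᵥ v :=
      continuous_id.matrix_mulVec continuous_const
    have := hsum.hasSum.map ((mulVecBilin 𝕜 𝕜).flip v).toAddMonoidHom hcont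
    refine this.congr_fun fun k => ?_
    simp
  refine ⟨_, ?_, hv⟩
  have hcont : Continuous fun x : Fin n → 𝕜 => (c • 1 - A) *ᵥ x :=
    continuous_const.matrix_mulVec continuous_id
  have h1 := hv.map (mulVecLin (c • 1 - A)).toAddMonoidHom hcont
  have h2 := h1.tendsto_sum_nat
  have hpart : ∀ N : ℕ, ∑ k ∈ Finset.range N,
      (c • 1 - A) *ᵥ ((c ^ (k + 1))⁻¹ • (A ^ k *ᵥ v)) = v - (c ^ N)⁻¹ • (A ^ N *ᵥ v) := by
    intro N
    induction N with
    | zero => simp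
    | succ N ih =>
      rw [Finset.sum_range_succ, ih, mulVec_smul, sub_mulVec, smul_mulVec, one_mulVec, smul_sub,
        smul_smul, mulVec_mulVec, ← pow_succ', pow_succ c, mul_inv, inv_mul_cancel_right₀ hc]
      abel
  have h3 : Tendsto (fun N : ℕ => v - (c ^ N)⁻¹ • (A ^ N *ᵥ v)) atTop (𝓝 (v - 0)) := by
    refine tendsto_const_nhds.sub ?_
    have := (hv.summable.tendsto_atTop_zero).const_smul c
    rw [smul_zero] at this
    refine this.congr fun N => ?_
    rw [smul_smul, pow_succ, mul_inv, mul_comm, inv_mul_cancel_right₀ hc]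
  rw [sub_zero] at h3
  refine tendsto_nhds_unique (h2.congr fun N => ?_) h3
  exact hpart N

theorem spectralRadius_ne_top (A : Matrix (Fin n) (Fin n) ℂ) : spectralRadius ℂ A ≠ ⊤ := by
  rcases isEmpty_or_nonempty (Fin n) with hn | hn
  · have : Subsingleton (Matrix (Fin n) (Fin n) ℂ) := inferInstance
    simp [spectralRadius, spectrum.of_subsingleton]
  · exact ne_top_of_le_ne_top ENNReal.coe_ne_top (spectrum.spectralRadius_le_nnnorm A)

/-- Gelfand's formula gives `‖A ^ k‖ ≤ r ^ k` eventually, for an `r` between the spectral radius and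
`s`; compare with a geometric series. -/
theorem summable_norm_pow_div (A : Matrix (Fin n) (Fin n) ℂ) {s : ℝ}
    (hs : (spectralRadius ℂ A).toReal < s) :
    Summable fun k : ℕ => ‖A ^ k‖ / s ^ (k + 1) := by
  have hfin := spectralRadius_ne_top A
  obtain ⟨r, hr1, hr2⟩ := exists_between hs
  have hr0 : 0 ≤ r := ENNReal.toReal_nonneg.trans hr1.le
  have hs0 : 0 < s := hr0.trans_lt hr2
  have hlim := spectrum.pow_nnnorm_pow_one_div_tendsto_nhds_spectralRadius A
  have hlt : spectralRadius ℂ A < ENNReal.ofReal r :=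
    (ENNReal.lt_ofReal_iff_toReal_lt hfin).2 hr1
  have hev : ∀ᶠ k : ℕ in atTop, ‖A ^ k‖ ≤ r ^ k := by
    filter_upwards [hlim.eventually_lt_const hlt, eventually_gt_atTop 0] with k hk hk0
    have hk0' : (0 : ℝ) < k := by exact_mod_cast hk0
    have h1 := ENNReal.rpow_le_rpow hk.le hk0'.le
    rw [← ENNReal.rpow_mul, one_div_mul_cancel hk0'.ne', ENNReal.rpow_one, ENNReal.rpow_natCast,
      ← ENNReal.ofReal_pow hr0] at h1
    have h2 : ‖A ^ k‖₊ ≤ (r ^ k).toNNReal := ENNReal.coe_le_coe.1 h1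
    have h3 : ‖A ^ k‖ ≤ ((r ^ k).toNNReal : ℝ) := NNReal.coe_le_coe.2 h2
    rwa [Real.coe_toNNReal _ (by positivity)] at h3
  have hgeom : Summable fun k : ℕ => s⁻¹ * (r / s) ^ k :=
    (summable_geometric_of_lt_one (by positivity) ((div_lt_one hs0).2 hr2)).mul_left _
  refine summable_of_isBigO_nat hgeom (Asymptotics.IsBigO.of_bound 1 ?_)
  filter_upwards [hev] with k hk
  rw [one_mul, Real.norm_of_nonneg (by positivity), Real.norm_of_nonneg (by positivity), div_pow,
    pow_succ, ← div_div, div_eq_inv_mul _ s]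
  gcongr

/-- The operator norm for the sup norm depends only on absolute values of entries, so the complex
estimate also serves the real resolvent. -/
theorem norm_complexify_pow (A : Matrix (Fin n) (Fin n) ℝ) (k : ℕ) :
    ‖complexify A ^ k‖ = ‖A ^ k‖ := by
  have h : complexify A ^ k = (A ^ k).map Complex.ofReal :=
    (Matrix.map_pow A Complex.ofRealHom k).symm
  rw [h, linfty_opNorm_def, linfty_opNorm_def]
  simp

theorem complexify_pow (A : Matrix (Fin n) (Fin n) ℝ) (k : ℕ) :
    complexify A ^ k = complexify (A ^ k) :=
  (Matrix.map_pow A Complex.ofRealHom k).symm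

theorem exists_real_resolvent (A : Matrix (Fin n) (Fin n) ℝ) {s : ℝ} (hs : rho A < s)
    (v : Fin n → ℝ) :
    ∃ w, (s • 1 - A) *ᵥ w = v ∧
      HasSum (fun k : ℕ => (s ^ (k + 1))⁻¹ • (A ^ k *ᵥ v)) w := by
  have hs0 : 0 < s := ENNReal.toReal_nonneg.trans_lt hs
  refine exists_hasSum_resolvent A hs0.ne' ?_ v
  simpa [norm_complexify_pow, abs_of_pos hs0] using summable_norm_pow_div (complexify A) hs

theorem exists_complex_resolvent (A : Matrix (Fin n) (Fin n) ℝ) {c : ℂ} (hc : rho A < ‖c‖)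
    (v : Fin n → ℂ) :
    ∃ w, (c • 1 - complexify A) *ᵥ w = v ∧
      HasSum (fun k : ℕ => (c ^ (k + 1))⁻¹ • (complexify A ^ k *ᵥ v)) w := by
  have hc0 : 0 < ‖c‖ := ENNReal.toReal_nonneg.trans_lt hc
  exact exists_hasSum_resolvent _ (norm_pos_iff.1 hc0) (summable_norm_pow_div _ hc) v

theorem norm_le_rho {A : Matrix (Fin n) (Fin n) ℝ} {μ : ℂ} {v : Fin n → ℂ} (hv : v ≠ 0) {k : ℕ}
    (h : (complexify A - μ • 1) ^ k *ᵥ v = 0) : ‖μ‖ ≤ rho A := by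
  have hμ : μ ∈ spectrum ℂ (complexify A) := by
    rw [spectrum.mem_iff]
    intro hu
    rw [Algebra.algebraMap_eq_smul_one, ← IsUnit.neg_iff, neg_sub] at hu
    exact hv (mulVec_injective_of_isUnit (hu.pow k) (h.trans (mulVec_zero _).symm))
  have h1 : (‖μ‖₊ : ENNReal) ≤ spectralRadius ℂ (complexify A) :=
    le_iSup₂ (f := fun (k : ℂ) (_ : k ∈ spectrum ℂ (complexify A)) => (‖k‖₊ : ENNReal)) μ hμ
  exact ENNReal.toReal_mono (spectralRadius_ne_top _) h1

theorem exists_eigenvector_norm_eq_rho (hn : 1 ≤ n) (A : Matrix (Fin n) (Fin n) ℝ) :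
    ∃ (μ : ℂ) (v : Fin n → ℂ), ‖μ‖ = rho A ∧ v ≠ 0 ∧ (complexify A - μ • 1) *ᵥ v = 0 := by
  have : Nonempty (Fin n) := Fin.pos_iff_nonempty.1 hn
  obtain ⟨μ, hμ, hr⟩ := spectrum.exists_nnnorm_eq_spectralRadius (complexify A)
  rw [spectrum.mem_iff, Algebra.algebraMap_eq_smul_one, ← IsUnit.neg_iff, neg_sub,
    isUnit_iff_isUnit_det, isUnit_iff_ne_zero, not_not] at hμ
  obtain ⟨v, hv, hv'⟩ := exists_mulVec_eq_zero_iff.2 hμ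
  exact ⟨μ, v, by rw [rho, ← hr]; rfl, hv, hv'⟩

end Resolvent

/-! ### Duality, faces, and the first inclusion -/

section Cones
open Filter Topology

variable {n : ℕ} {K : PointedCone ℝ (Fin n → ℝ)} {A : Matrix (Fin n) (Fin n) ℝ}

theorem mem_dualCone {z : Fin n → ℝ} : z ∈ dualCone K ↔ ∀ x ∈ K, 0 ≤ z ⬝ᵥ x := by
  simp [dualCone, dotProductBilin, dotProduct_comm]

theorem pow_mulVec_mem (hA : A ∈ positiveMaps K) {x : Fin n → ℝ} (hx : x ∈ K) (k : ℕ) :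
    A ^ k *ᵥ x ∈ K := by
  induction k with
  | zero => simpa
  | succ k ih => rw [pow_succ', ← mulVec_mulVec]; exact hA _ ih

theorem IsProperCone.mem_of_hasSum (hK : IsProperCone K) {f : ℕ → Fin n → ℝ}
    {w : Fin n → ℝ} (hf : ∀ k, f k ∈ K) (h : HasSum f w) : w ∈ K :=
  hK.isClosed.mem_of_tendsto h.tendsto_sum_nat
    (Eventually.of_forall fun _ => K.sum_mem fun k _ => hf k)

theorem IsProperCone.span_eq_top (hK : IsProperCone K) :
    Submodule.span ℝ (K : Set (Fin n → ℝ)) = ⊤ :=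
  Submodule.eq_top_of_nonempty_interior' _
    (hK.interior_nonempty.mono (interior_mono Submodule.subset_span))

theorem IsProperCone.mem_of_dual (hK : IsProperCone K) {w : Fin n → ℝ}
    (hw : ∀ z ∈ dualCone K, 0 ≤ z ⬝ᵥ w) : w ∈ K := by
  by_contra hwK
  let C : ProperCone ℝ (Fin n → ℝ) := ⟨K, hK.isClosed⟩
  obtain ⟨f, hf, hfw⟩ := C.hyperplane_separation_point (x₀ := w) hwK
  have hrep : ∀ x, f x = (fun i => f (fun j => if i = j then 1 else 0)) ⬝ᵥ x := fun x => by
    have := LinearMap.pi_apply_eq_sum_univ (f : (Fin n → ℝ) →ₗ[ℝ] ℝ) x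
    simp only [ContinuousLinearMap.coe_coe, smul_eq_mul] at this
    rw [this, dotProduct]
    exact Finset.sum_congr rfl fun i _ => mul_comm _ _
  have hz := hw _ (mem_dualCone.2 fun x hx => by rw [← hrep]; exact hf x hx)
  rw [← hrep] at hz
  exact absurd hz (not_le.2 hfw)

theorem IsProperCone.eq_zero_of_dual (hK : IsProperCone K) {w : Fin n → ℝ}
    (hw : ∀ z ∈ dualCone K, z ⬝ᵥ w = 0) : w = 0 :=
  hK.eq_zero_of_neg_mem w (hK.mem_of_dual fun z hz => (hw z hz).ge)
    (hK.mem_of_dual fun z hz => by rw [dotProduct_neg, hw z hz, neg_zero])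

theorem IsProperCone.complex_eq_zero_of_dual (hK : IsProperCone K) {w : Fin n → ℂ}
    (hw : ∀ z ∈ dualCone K, (fun i => (z i : ℂ)) ⬝ᵥ w = 0) : w = 0 := by
  have hre : (fun i => (w i).re) = 0 := hK.eq_zero_of_dual fun z hz => by
    have := congrArg Complex.re (hw z hz)
    simpa [dotProduct] using this
  have him : (fun i => (w i).im) = 0 := hK.eq_zero_of_dual fun z hz => by
    have := congrArg Complex.im (hw z hz)
    simpa [dotProduct] using this
  ext i
  exact Complex.ext (congrFun hre i) (congrFun him i)

theorem subset_faceGenerated (S : Set (Fin n → ℝ)) :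
    S ⊆ (faceGenerated K S : Set (Fin n → ℝ)) := fun _ hx =>
  Submodule.mem_sInf.2 fun _ hF => hF.2 hx

theorem faceGenerated_le {F : PointedCone ℝ (Fin n → ℝ)} (hF : F.IsFaceOf K)
    {S : Set (Fin n → ℝ)} (hS : S ⊆ F) : faceGenerated K S ≤ F :=
  sInf_le ⟨hF, hS⟩

theorem isFaceOf_faceGenerated {S : Set (Fin n → ℝ)} (hS : S ⊆ K) :
    (faceGenerated K S).IsFaceOf K := by
  refine ⟨faceGenerated_le (.refl K) hS, fun hx hy ha h => Submodule.mem_sInf.2 fun F hF => ?_⟩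
  exact hF.1.mem_of_smul_add_mem hx hy ha ((Submodule.mem_sInf.1 h) F hF)

/-- The face of `K` cut out by the hyperplane orthogonal to an element of the dual cone. -/
theorem exists_isFaceOf_orthogonal {z : Fin n → ℝ} (hz : ∀ x ∈ K, 0 ≤ z ⬝ᵥ x) :
    ∃ F : PointedCone ℝ (Fin n → ℝ), F.IsFaceOf K ∧ ∀ x, x ∈ F ↔ x ∈ K ∧ z ⬝ᵥ x = 0 := by
  refine ⟨{ carrier := {x | x ∈ K ∧ z ⬝ᵥ x = 0}, add_mem' := ?_, zero_mem' := ?_,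
            smul_mem' := ?_ }, ⟨fun x hx => hx.1, ?_⟩, fun x => Iff.rfl⟩
  · rintro a b ⟨ha, ha'⟩ ⟨hb, hb'⟩
    exact ⟨K.add_mem ha hb, by rw [dotProduct_add, ha', hb', add_zero]⟩
  · exact ⟨K.zero_mem, dotProduct_zero z⟩
  · rintro c x ⟨hx, hx'⟩
    refine ⟨Submodule.smul_mem K c hx, ?_⟩
    rw [← Nonneg.coe_smul, dotProduct_smul, hx', smul_zero]
  · rintro x y a hx hy ha ⟨-, h⟩
    refine ⟨hx, le_antisymm ?_ (hz x hx)⟩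
    rw [dotProduct_add, dotProduct_smul, smul_eq_mul] at h
    have h1 := hz y hy
    by_contra hcon
    have := mul_pos ha (not_le.1 hcon)
    linarith

theorem mem_of_isFaceOf_of_mem_span {F : PointedCone ℝ (Fin n → ℝ)} (hF : F.IsFaceOf K)
    {x : Fin n → ℝ} (hxK : x ∈ K) (hxF : x ∈ Submodule.span ℝ (F : Set (Fin n → ℝ))) : x ∈ F := by
  obtain ⟨a, ha, b, hb, rfl⟩ : ∃ a ∈ F, ∃ b ∈ F, a - b = x := by
    clear hxK
    induction hxF using Submodule.span_induction with
    | mem x hx => exact ⟨x, hx, 0, F.zero_mem, sub_zero x⟩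
    | zero => exact ⟨0, F.zero_mem, 0, F.zero_mem, sub_zero 0⟩
    | add x y _ _ hx hy =>
      obtain ⟨a, ha, b, hb, rfl⟩ := hx
      obtain ⟨a', ha', b', hb', rfl⟩ := hy
      exact ⟨a + a', F.add_mem ha ha', b + b', F.add_mem hb hb', by abel⟩
    | smul c x _ hx =>
      obtain ⟨a, ha, b, hb, rfl⟩ := hx
      rcases le_total 0 c with hc | hc
      · exact ⟨c • a, F.smul_mem hc ha, c • b, F.smul_mem hc hb, (smul_sub c a b).symm⟩
      · refine ⟨-c • b, F.smul_mem (neg_nonneg.2 hc) hb, -c • a,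
          F.smul_mem (neg_nonneg.2 hc) ha, ?_⟩
        rw [neg_smul, neg_smul, smul_sub]; abel
  exact hF.mem_of_add_mem_left hxK (hF.le hb) (by rwa [sub_add_cancel])

theorem isFaceOf_genEigenFace : (genEigenFace K A).IsFaceOf K :=
  isFaceOf_faceGenerated Set.inter_subset_right

/-- The vectors of `K` that `A` sends into the face form a face of `K` themselves, and it contains
the generators because `A` commutes with `(ρ - A)^n`. -/
theorem mulVec_mem_genEigenFace (hA : A ∈ positiveMaps K) {x : Fin n → ℝ}
    (hx : x ∈ genEigenFace K A) : A *ᵥ x ∈ genEigenFace K A := by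
  have hface := isFaceOf_genEigenFace (K := K) (A := A)
  let G : PointedCone ℝ (Fin n → ℝ) :=
    { carrier := {x | x ∈ K ∧ A *ᵥ x ∈ genEigenFace K A}
      add_mem' := fun ha hb => ⟨K.add_mem ha.1 hb.1, by
        rw [mulVec_add]; exact Submodule.add_mem _ ha.2 hb.2⟩
      zero_mem' := ⟨K.zero_mem, by rw [mulVec_zero]; exact Submodule.zero_mem _⟩
      smul_mem' := fun c x hx => ⟨Submodule.smul_mem K c hx.1, by
        rw [← Nonneg.coe_smul, mulVec_smul]
        exact PointedCone.smul_mem _ c.2 hx.2⟩ }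
  have hG : G.IsFaceOf K := by
    refine ⟨fun x hx => hx.1, ?_⟩
    rintro x y a hx hy ha ⟨-, h⟩
    refine ⟨hx, hface.mem_of_smul_add_mem (hA x hx) (hA y hy) ha ?_⟩
    rwa [← mulVec_smul, ← mulVec_add]
  have hsub : genEigenFace K A ≤ G := by
    refine faceGenerated_le hG ?_
    rintro x ⟨hx, hxK⟩
    refine ⟨hxK, subset_faceGenerated _ ⟨?_, hA x hxK⟩⟩
    have hcomm : Commute A ((rho A • (1 : Matrix (Fin n) (Fin n) ℝ) - A) ^ n) :=
      (((Commute.one_right A).smul_right _).sub_right (Commute.refl A)).pow_right n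
    simp only [nullSpace, SetLike.mem_coe, LinearMap.mem_ker, toLin'_apply] at hx ⊢
    rw [mulVec_mulVec, ← hcomm.eq, ← mulVec_mulVec, hx, mulVec_zero]
  exact (hsub hx).2

theorem shiftImage_inter_subset (hA : A ∈ positiveMaps K) :
    (K : Set (Fin n → ℝ)) ∩ shiftImage A (genEigenFace K A) ⊆ genEigenFace K A := by
  rintro _ ⟨hK, x, hx, rfl⟩
  refine mem_of_isFaceOf_of_mem_span isFaceOf_genEigenFace hK ?_
  simp only [sub_mulVec, smul_mulVec, one_mulVec]
  exact Submodule.sub_mem _ (Submodule.subset_span (mulVec_mem_genEigenFace hA hx))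
    (Submodule.smul_mem _ _ (Submodule.subset_span hx))

/-- Eigenvectors of `Aᵀ` annihilate the range of `A - ρ`; since `x ∈ K`, its annihilator in `K*` is
a face, so the property spreads to the generated face. -/
theorem dotProduct_eq_zero_of_mem_dualEigenFace {z x : Fin n → ℝ}
    (hz : z ∈ dualEigenFace K A) (hxK : x ∈ K)
    (hx : ∃ v, (A - rho A • (1 : Matrix (Fin n) (Fin n) ℝ)) *ᵥ v = x) : z ⬝ᵥ x = 0 := by
  obtain ⟨F, hF, hmem⟩ := exists_isFaceOf_orthogonal (K := dualCone K) (z := x) fun w hw => by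
    rw [dotProduct_comm]; exact mem_dualCone.1 hw x hxK
  obtain ⟨v, rfl⟩ := hx
  have hle : dualEigenFace K A ≤ F := by
    refine faceGenerated_le hF ?_
    rintro w ⟨hw, hwK⟩
    refine (hmem w).2 ⟨hwK, ?_⟩
    simp only [nullSpace, SetLike.mem_coe, LinearMap.mem_ker, toLin'_apply] at hw
    rw [dotProduct_comm, dotProduct_mulVec, ← mulVec_transpose, transpose_sub, transpose_smul,
      transpose_one, ← neg_sub, neg_mulVec, hw, neg_zero, zero_dotProduct]
  rw [dotProduct_comm]
  exact ((hmem z).1 (hle hz)).2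

theorem faceGenerated_shiftImage_subset (hA : A ∈ positiveMaps K) :
    (faceGenerated K ((K : Set (Fin n → ℝ)) ∩ shiftImage A (genEigenFace K A)) :
        Set (Fin n → ℝ)) ⊆
      (genEigenFace K A : Set (Fin n → ℝ)) ∩ dualFace (dualCone K) (dualEigenFace K A) := by
  intro y hy
  have hyF := faceGenerated_le isFaceOf_genEigenFace (shiftImage_inter_subset hA) hy
  have hyK : y ∈ K := isFaceOf_genEigenFace.le hyF
  have horth : ∀ z ∈ dualEigenFace K A, z ⬝ᵥ y = 0 := by
    intro z hz
    have hzK : z ∈ dualCone K := (isFaceOf_faceGenerated Set.inter_subset_right).le hz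
    obtain ⟨F, hF, hmem⟩ := exists_isFaceOf_orthogonal (mem_dualCone.1 hzK)
    refine ((hmem y).1 (faceGenerated_le hF ?_ hy)).2
    rintro _ ⟨hxK, v, -, rfl⟩
    exact (hmem _).2 ⟨hxK, dotProduct_eq_zero_of_mem_dualEigenFace hz hxK ⟨v, rfl⟩⟩
  refine ⟨hyF, fun z hz => ?_, mem_dualCone.2 fun z hz => ?_⟩
  · induction hz using Submodule.span_induction with
    | mem z hz => exact horth z hz
    | zero => exact zero_dotProduct y
    | add a b _ _ ha hb => rw [add_dotProduct, ha, hb, add_zero]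
    | smul c a _ ha => rw [smul_dotProduct, ha, smul_zero]
  · rw [dotProduct_comm]; exact mem_dualCone.1 hz y hyK

end Cones

/-! ### Domination by generalized eigenvectors, and the equality -/

section Domination
open Filter Topology

variable {n : ℕ} {K : PointedCone ℝ (Fin n → ℝ)} {A : Matrix (Fin n) (Fin n) ℝ}

theorem eq_zero_of_resolvent (A : Matrix (Fin n) (Fin n) ℝ) {s : ℝ} (hs : rho A < s)
    {a : Fin n → ℝ} (ha : (s • 1 - A) *ᵥ a = 0) : a = 0 := by
  have hsurj : Function.Surjective (mulVecLin (s • 1 - A)) := fun v =>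
    (exists_real_resolvent A hs v).imp fun _ h => h.1
  exact (LinearMap.injective_iff_surjective.2 hsurj) (ha.trans (map_zero (mulVecLin _)).symm)

/-- The difference is a tail of the Neumann series, whose terms all lie in the closed cone. -/
theorem IsProperCone.resolvent_sub_mem (hK : IsProperCone K) (hA : A ∈ positiveMaps K)
    {s : ℝ} (hs : rho A < s) {y w : Fin n → ℝ} (hy : y ∈ K) (hw : (s • 1 - A) *ᵥ w = y)
    (N : ℕ) : w - ∑ k ∈ Finset.range N, (s ^ (k + 1))⁻¹ • (A ^ k *ᵥ y) ∈ K := by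
  have hs0 : 0 < s := ENNReal.toReal_nonneg.trans_lt hs
  obtain ⟨w', hw', hsum⟩ := exists_real_resolvent A hs y
  obtain rfl : w = w' := by
    refine sub_eq_zero.1 (eq_zero_of_resolvent A hs ?_)
    rw [mulVec_sub, hw, hw', sub_self]
  exact hK.mem_of_hasSum
    (fun k => PointedCone.smul_mem K (by positivity) (pow_mulVec_mem hA hy (k + N)))
    ((hasSum_nat_add_iff' N).2 hsum)

theorem IsProperCone.resolvent_mem (hK : IsProperCone K) (hA : A ∈ positiveMaps K)
    {s : ℝ} (hs : rho A < s) {y w : Fin n → ℝ} (hy : y ∈ K) (hw : (s • 1 - A) *ᵥ w = y) :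
    w ∈ K := by
  simpa using hK.resolvent_sub_mem hA hs hy hw 0

theorem pow_mulVec_mem_range {𝕜 : Type*} [Field 𝕜] (A : Matrix (Fin n) (Fin n) 𝕜)
    (v : Fin n → 𝕜) (k : ℕ) :
    ∃ c : Fin n → 𝕜, ∑ j, c j • (A ^ (j : ℕ) *ᵥ v) = A ^ k *ᵥ v := by
  set p := (Polynomial.X ^ k : Polynomial 𝕜) %ₘ A.charpoly with hp
  have hA : A ^ k = Polynomial.aeval A p := Matrix.pow_eq_aeval_mod_charpoly A k
  refine ⟨fun j => p.coeff j, ?_⟩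
  rcases isEmpty_or_nonempty (Fin n) with hn | hn
  · ext i; exact hn.elim i
  have hn0 : 0 < n := Fin.pos_iff_nonempty.2 hn
  have hdeg : p.natDegree < n := by
    have h := Polynomial.natDegree_modByMonic_lt (Polynomial.X ^ k : Polynomial 𝕜)
      A.charpoly_monic (fun h => by
        have := A.charpoly_natDegree_eq_dim
        rw [h, Polynomial.natDegree_one, Fintype.card_fin] at this
        omega)
    rwa [A.charpoly_natDegree_eq_dim, Fintype.card_fin] at h
  rw [hA, Polynomial.aeval_eq_sum_range' hdeg, sum_mulVec,
    Fin.sum_univ_eq_sum_range (fun j => p.coeff j • (A ^ j *ᵥ v))]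
  exact Finset.sum_congr rfl fun j _ => (smul_mulVec _ _ _).symm

/-- If `A x - ρ(A) x` lies in the cone, then `x` is dominated by a generalized eigenvector. -/
theorem IsProperCone.exists_add_mem_nullSpace (hK : IsProperCone K) (hA : A ∈ positiveMaps K)
    {x : Fin n → ℝ} (hy : (A - rho A • (1 : Matrix (Fin n) (Fin n) ℝ)) *ᵥ x ∈ K) :
    ∃ w ∈ K, x + w ∈ nullSpace ((rho A • (1 : Matrix (Fin n) (Fin n) ℝ) - A) ^ n) := by
  obtain ⟨E, J, h⟩ := exists_isSpectralSplitting A (rho A)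
  set y := (A - rho A • (1 : Matrix (Fin n) (Fin n) ℝ)) *ᵥ x with hydef
  have hQ : ∀ k, Commute (1 - E) (A ^ k) := fun k =>
    ((Commute.one_left A).sub_left h.comm).pow_right k
  let L : (Fin n → ℝ) →ₗ[ℝ] (Fin n → ℝ) :=
    Fintype.linearCombination ℝ fun k : Fin n => A ^ (k : ℕ) *ᵥ ((1 - E) *ᵥ y)
  have hL : ∀ c, L c = ∑ k, c k • (A ^ (k : ℕ) *ᵥ ((1 - E) *ᵥ y)) := fun c =>
    Fintype.linearCombination_apply ℝ _ c
  -- A linear choice of coefficients on the range of `L`; continuity then makes the coefficients of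
  -- a small vector small.
  obtain ⟨g, hg⟩ : ∃ g : (Fin n → ℝ) →ₗ[ℝ] (Fin n → ℝ), ∀ d ∈ LinearMap.range L, L (g d) = d := by
    obtain ⟨g₀, hg₀⟩ := L.rangeRestrict.exists_rightInverse_of_surjective L.range_rangeRestrict
    obtain ⟨g, hg⟩ := g₀.exists_extend
    refine ⟨g, fun d hd => ?_⟩
    have h1 : g d = g₀ ⟨d, hd⟩ := LinearMap.congr_fun hg ⟨d, hd⟩
    rw [h1]
    exact congrArg Subtype.val (LinearMap.congr_fun hg₀ ⟨d, hd⟩)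
  choose! v hv using fun (s : ℝ) (hs : rho A < s) =>
    (exists_real_resolvent A hs x).imp fun _ h => h.1
  have hev : ∀ᶠ s in 𝓝[>] rho A, (s • 1 - A) *ᵥ v s = x := by
    filter_upwards [self_mem_nhdsWithin] with s hs using hv s hs
  let w : ℝ → Fin n → ℝ := fun s => (s - rho A) • v s - x
  have hw : ∀ s, rho A < s → (s • 1 - A) *ᵥ w s = y := by
    intro s hs
    simp only [w]
    rw [mulVec_sub, mulVec_smul, hv s hs, hydef]
    simp only [sub_mulVec, smul_mulVec, one_mulVec, sub_smul]
    abel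
  have hid : Tendsto (fun s : ℝ => s) (𝓝[>] rho A) (𝓝 (rho A)) :=
    tendsto_nhdsWithin_of_tendsto_nhds tendsto_id
  let d : ℝ → Fin n → ℝ := fun s => (s - rho A) • ((1 - E) *ᵥ v s)
  have hd : Tendsto d (𝓝[>] rho A) (𝓝 0) := h.tendsto_sub_smul_compl hid hev
  have hdw : ∀ s, (1 - E) *ᵥ (x + w s) = d s := fun s => by
    simp only [w, d]; rw [add_sub_cancel, mulVec_smul]
  have hrange : ∀ k, A ^ k *ᵥ ((1 - E) *ᵥ y) ∈ LinearMap.range L := fun k => by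
    obtain ⟨c, hc⟩ := pow_mulVec_mem_range A ((1 - E) *ᵥ y) k
    exact ⟨c, by rw [hL, hc]⟩
  have hclosed : IsClosed (LinearMap.range L : Set (Fin n → ℝ)) :=
    Submodule.closed_of_finiteDimensional _
  have hQw : ∀ s, rho A < s → (1 - E) *ᵥ w s ∈ LinearMap.range L := by
    intro s hs
    obtain ⟨w', hw', hsum⟩ := exists_real_resolvent A hs y
    have hww : w s = w' := by
      refine sub_eq_zero.1 (eq_zero_of_resolvent A hs ?_)
      rw [mulVec_sub, hw s hs, hw', sub_self]
    rw [hww]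
    have hsum' := hsum.map (mulVecLin (1 - E)).toAddMonoidHom
      (continuous_const.matrix_mulVec continuous_id)
    refine hclosed.mem_of_tendsto hsum'.tendsto_sum_nat
      (Eventually.of_forall fun N => Submodule.sum_mem _ fun k _ => ?_)
    have : (mulVecLin (1 - E)) ((s ^ (k + 1))⁻¹ • (A ^ k *ᵥ y)) =
        (s ^ (k + 1))⁻¹ • (A ^ k *ᵥ ((1 - E) *ᵥ y)) := by
      rw [map_smul, mulVecLin_apply, mulVec_mulVec, (hQ k).eq, ← mulVec_mulVec]
    change (mulVecLin (1 - E)) ((s ^ (k + 1))⁻¹ • (A ^ k *ᵥ y)) ∈ LinearMap.range L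
    rw [this]
    exact Submodule.smul_mem _ _ (hrange k)
  -- Since `d s → 0`, the vector `-(1 - E)x` is a limit of the vectors `(1 - E)w(s)`, all in the
  -- closed range of `L`.
  have hQx : (1 - E) *ᵥ x ∈ LinearMap.range L := by
    have hlim := hd.sub_const ((1 - E) *ᵥ x)
    rw [zero_sub] at hlim
    refine neg_mem_iff.1 (hclosed.mem_of_tendsto hlim ?_)
    filter_upwards [self_mem_nhdsWithin] with s hs
    rw [← hdw, mulVec_add, add_sub_cancel_left]
    exact hQw s hs
  have hdrange : ∀ s, rho A < s → d s ∈ LinearMap.range L := fun s hs => by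
    rw [← hdw, mulVec_add]; exact Submodule.add_mem _ hQx (hQw s hs)
  have hgd : Tendsto (fun s => g (d s)) (𝓝[>] rho A) (𝓝 0) := by
    have := (g.continuous_of_finiteDimensional.tendsto 0).comp hd
    rwa [map_zero] at this
  have hρ : 0 ≤ rho A := ENNReal.toReal_nonneg
  -- For `s ≤ ρ + 1` the Neumann coefficient `s^-(k+1)` is at least this bound, so subtracting `g (d
  -- s) k` leaves it nonnegative.
  have hsmall : ∀ᶠ s in 𝓝[>] rho A, ∀ k : Fin n, g (d s) k ≤ ((rho A + 1) ^ ((k : ℕ) + 1))⁻¹ :=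
    eventually_all.2 fun k => (tendsto_pi_nhds.1 hgd k).eventually_le_const
      (by simp only [Pi.zero_apply]; positivity)
  have hle : ∀ᶠ s in 𝓝[>] rho A, s ≤ rho A + 1 := hid.eventually_le_const (by linarith)
  obtain ⟨s, hs1, hs2, hs⟩ := (hsmall.and (hle.and self_mem_nhdsWithin)).exists
  have hs : rho A < s := hs
  refine ⟨w s - ∑ k : Fin n, g (d s) k • (A ^ (k : ℕ) *ᵥ y), ?_, ?_⟩
  · have h1 := hK.resolvent_sub_mem hA hs hy (hw s hs) n
    rw [← Fin.sum_univ_eq_sum_range (fun k => (s ^ (k + 1))⁻¹ • (A ^ k *ᵥ y))] at h1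
    have h2 : ∑ k : Fin n, ((s ^ ((k : ℕ) + 1))⁻¹ - g (d s) k) • (A ^ (k : ℕ) *ᵥ y) ∈ K := by
      refine K.sum_mem fun k _ => PointedCone.smul_mem K ?_ (pow_mulVec_mem hA hy k)
      have h3 : ((rho A + 1) ^ ((k : ℕ) + 1))⁻¹ ≤ (s ^ ((k : ℕ) + 1))⁻¹ := by
        have : 0 < s := hρ.trans_lt hs
        gcongr
      linarith [hs1 k]
    have h3 := K.add_mem h1 h2
    simp only [sub_smul, Finset.sum_sub_distrib] at h3
    rwa [sub_add_sub_cancel] at h3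
  · have hker : (1 - E) *ᵥ (x + (w s - ∑ k : Fin n, g (d s) k • (A ^ (k : ℕ) *ᵥ y))) = 0 := by
      rw [← add_sub_assoc, mulVec_sub, hdw, mulVec_sum, sub_eq_zero]
      conv_lhs => rw [← hg (d s) (hdrange s hs), hL]
      refine Finset.sum_congr rfl fun k _ => ?_
      rw [mulVec_smul, mulVec_mulVec _ (A ^ (k : ℕ)), mulVec_mulVec _ (1 - E), (hQ k).eq]
    rw [sub_mulVec, one_mulVec, sub_eq_zero] at hker
    rw [nullSpace, LinearMap.mem_ker, toLin'_apply, hker, mulVec_mulVec, ← neg_sub, neg_pow,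
      mul_assoc, h.pow_mul, mul_zero, zero_mulVec]

theorem shiftImage_inter_eq (hK : IsProperCone K) (hA : A ∈ positiveMaps K) :
    shiftImage A (K : Set (Fin n → ℝ)) ∩ K =
      (K : Set (Fin n → ℝ)) ∩ shiftImage A (genEigenFace K A) := by
  ext y
  constructor
  · rintro ⟨⟨x, hx, rfl⟩, hy⟩
    refine ⟨hy, x, ?_, rfl⟩
    obtain ⟨w, hwK, hw⟩ := hK.exists_add_mem_nullSpace hA hy
    exact isFaceOf_genEigenFace.mem_of_add_mem_left hx hwK
      (subset_faceGenerated _ ⟨hw, K.add_mem hx hwK⟩)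
  · rintro ⟨hy, x, hx, rfl⟩
    exact ⟨⟨x, isFaceOf_genEigenFace.le hx, rfl⟩, hy⟩

end Domination

/-! ### Eigenvalues of modulus equal to the spectral radius -/

section Peripheral
open Filter Topology

variable {n : ℕ} {K : PointedCone ℝ (Fin n → ℝ)} {A : Matrix (Fin n) (Fin n) ℝ}

theorem complexify_mulVec (A : Matrix (Fin n) (Fin n) ℝ) (x : Fin n → ℝ) :
    complexify A *ᵥ (fun i => (x i : ℂ)) = fun i => ((A *ᵥ x) i : ℂ) := by
  ext i
  simp [complexify, mulVec, dotProduct]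

/-- The resolvent at a complex point is dominated by the resolvent at its modulus. -/
theorem norm_dotProduct_resolvent_le (hA : A ∈ positiveMaps K) {s : ℝ} (hs : rho A < s) {c : ℂ}
    (hc : ‖c‖ = s) {y w z : Fin n → ℝ} {u : Fin n → ℂ} (hy : y ∈ K) (hz : z ∈ dualCone K)
    (hw : HasSum (fun k : ℕ => (s ^ (k + 1))⁻¹ • (A ^ k *ᵥ y)) w)
    (hu : HasSum (fun k : ℕ => (c ^ (k + 1))⁻¹ • (complexify A ^ k *ᵥ fun i => (y i : ℂ))) u) :
    ‖(fun i => (z i : ℂ)) ⬝ᵥ u‖ ≤ z ⬝ᵥ w := by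
  have hs0 : 0 < s := ENNReal.toReal_nonneg.trans_lt hs
  have h1 := hw.map (dotProductBilin ℝ ℝ z).toAddMonoidHom
    (LinearMap.continuous_of_finiteDimensional (dotProductBilin ℝ ℝ z))
  have h2 := hu.map (dotProductBilin ℂ ℂ fun i => (z i : ℂ)).toAddMonoidHom
    (LinearMap.continuous_of_finiteDimensional (dotProductBilin ℂ ℂ fun i => (z i : ℂ)))
  have h3 := tsum_of_norm_bounded h1 (f := fun k : ℕ => (fun i => (z i : ℂ)) ⬝ᵥ
    ((c ^ (k + 1))⁻¹ • (complexify A ^ k *ᵥ fun i => (y i : ℂ)))) fun k => ?_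
  · rwa [show (∑' k : ℕ, (fun i => (z i : ℂ)) ⬝ᵥ
      ((c ^ (k + 1))⁻¹ • (complexify A ^ k *ᵥ fun i => (y i : ℂ)))) = _ from h2.tsum_eq] at h3
  · change _ ≤ z ⬝ᵥ ((s ^ (k + 1))⁻¹ • (A ^ k *ᵥ y))
    have h4 : (fun i => (z i : ℂ)) ⬝ᵥ (fun i => ((A ^ k *ᵥ y) i : ℂ)) =
        ((z ⬝ᵥ (A ^ k *ᵥ y) : ℝ) : ℂ) := by
      simp [dotProduct]
    have h5 := mem_dualCone.1 hz _ (pow_mulVec_mem hA hy k)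
    rw [complexify_pow, complexify_mulVec, dotProduct_smul, dotProduct_smul, h4, norm_smul,
      norm_inv, norm_pow, hc, Complex.norm_real, Real.norm_of_nonneg h5, smul_eq_mul]

/-- On a peripheral eigenvalue, the order of a vector of the cone is at most its order for the
spectral radius. -/
theorem IsProperCone.peripheral_pow_mulVec_eq_zero (hK : IsProperCone K)
    (hA : A ∈ positiveMaps K) {E J : Matrix (Fin n) (Fin n) ℝ}
    (h : IsSpectralSplitting A (rho A) E J) {μ : ℂ} (hμ : ‖μ‖ = rho A)
    {E' J' : Matrix (Fin n) (Fin n) ℂ} (h' : IsSpectralSplitting (complexify A) μ E' J')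
    {y : Fin n → ℝ} (hy : y ∈ K) {m : ℕ}
    (hm : (A - rho A • 1) ^ m *ᵥ (E *ᵥ y) = 0) :
    (complexify A - μ • 1) ^ m *ᵥ (E' *ᵥ fun i => (y i : ℂ)) = 0 := by
  -- Approach `μ` radially along `sθ`, so that the moduli are exactly `s`. If `μ = 0`, any unit `θ`
  -- serves.
  obtain ⟨θ, hθ, hθμ⟩ : ∃ θ : ℂ, ‖θ‖ = 1 ∧ μ = (rho A : ℂ) * θ := by
    by_cases h0 : μ = 0
    · refine ⟨1, norm_one, ?_⟩
      rw [← hμ, h0]; simp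
    · refine ⟨μ / (rho A : ℂ), ?_, ?_⟩
      · rw [norm_div, Complex.norm_real, ← hμ, norm_norm, div_self (norm_ne_zero_iff.2 h0)]
      · rw [mul_div_cancel₀]
        rw [← hμ]; exact_mod_cast norm_ne_zero_iff.2 h0
  have hge : ∀ p, m ≤ p → (A - rho A • 1) ^ p *ᵥ (E *ᵥ y) = 0 := fun p hp => by
    rw [← pow_sub_mul_pow _ hp, ← mulVec_mulVec, hm, mulVec_zero]
  have hρ : 0 ≤ rho A := ENNReal.toReal_nonneg
  choose! w hw using fun (s : ℝ) (hs : rho A < s) => exists_real_resolvent A hs y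
  have hnorm : ∀ s : ℝ, rho A < s → ‖(s : ℂ) * θ‖ = s := fun s hs => by
    rw [norm_mul, hθ, mul_one, Complex.norm_real, Real.norm_of_nonneg (hρ.trans hs.le)]
  choose! u hu using fun (s : ℝ) (hs : rho A < s) =>
    exists_complex_resolvent A (c := (s : ℂ) * θ) (by rw [hnorm s hs]; exact hs)
      (fun i => (y i : ℂ))
  have hsub : ∀ s : ℝ, (s : ℂ) * θ - μ = ((s - rho A : ℝ) : ℂ) * θ := fun s => by
    rw [hθμ]; push_cast; ring
  have hθ0 : θ ≠ 0 := norm_ne_zero_iff.1 (by rw [hθ]; exact one_ne_zero)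
  have hreal : Tendsto (fun s : ℝ => s) (𝓝[>] rho A) (𝓝[≠] rho A) :=
    tendsto_id.mono_left (nhdsWithin_mono _ fun s hs => ne_of_gt hs)
  have hcplx : Tendsto (fun s : ℝ => (s : ℂ) * θ) (𝓝[>] rho A) (𝓝[≠] μ) := by
    refine tendsto_nhdsWithin_iff.2 ⟨?_, ?_⟩
    · rw [hθμ]
      exact (((Complex.continuous_ofReal.mul continuous_const).tendsto (rho A))).mono_left
        nhdsWithin_le_nhds
    · filter_upwards [self_mem_nhdsWithin] with s hs
      rw [Set.mem_compl_iff, Set.mem_singleton_iff, ← sub_eq_zero, hsub, mul_eq_zero, not_or]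
      exact ⟨by exact_mod_cast (sub_pos.2 hs).ne', hθ0⟩
  -- Lowers the order by one: the coefficient of order `p + 1` at `μ` is dominated, against each `z
  -- ∈ K*`, by the one at `ρ`, which vanishes for `p ≥ m`.
  have hstep : ∀ p, m ≤ p →
      (complexify A - μ • 1) ^ (p + 1) *ᵥ (E' *ᵥ fun i => (y i : ℂ)) = 0 →
      (complexify A - μ • 1) ^ p *ᵥ (E' *ᵥ fun i => (y i : ℂ)) = 0 := by
    intro p hp hzero
    have h1 := h.tendsto_pow_smul hreal (w := w)
      (by filter_upwards [self_mem_nhdsWithin] with s hs using (hw s hs).1)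
      (Nat.le_add_left 1 p) (hge (p + 1) (by omega))
    have h2 := h'.tendsto_pow_smul hcplx (w := u)
      (by filter_upwards [self_mem_nhdsWithin] with s hs using (hu s hs).1)
      (Nat.le_add_left 1 p) hzero
    rw [Nat.add_sub_cancel] at h1 h2
    rw [hge p hp] at h1
    refine hK.complex_eq_zero_of_dual fun z hz => ?_
    have h3 := ((LinearMap.continuous_of_finiteDimensional
      (dotProductBilin ℂ ℂ fun i => (z i : ℂ))).tendsto _).comp h2
    have h4 := ((LinearMap.continuous_of_finiteDimensional
      (dotProductBilin ℝ ℝ z)).tendsto _).comp h1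
    rw [map_zero] at h4
    refine tendsto_nhds_unique h3 (squeeze_zero_norm' ?_ h4)
    filter_upwards [self_mem_nhdsWithin] with s hs
    change ‖(fun i => (z i : ℂ)) ⬝ᵥ (((s : ℂ) * θ - μ) ^ (p + 1) • u s)‖ ≤
      z ⬝ᵥ ((s - rho A) ^ (p + 1) • w s)
    have hs' : 0 ≤ s - rho A := (sub_pos.2 hs).le
    rw [dotProduct_smul, dotProduct_smul, norm_smul, norm_pow, hsub, norm_mul, hθ, mul_one,
      Complex.norm_real, Real.norm_of_nonneg hs', smul_eq_mul]
    exact mul_le_mul_of_nonneg_left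
      (norm_dotProduct_resolvent_le hA hs (hnorm s hs) hy hz (hw s hs).2 (hu s hs).2)
      (by positivity)
  have hdesc : ∀ j, (complexify A - μ • 1) ^ (m + j) *ᵥ (E' *ᵥ fun i => (y i : ℂ)) = 0 →
      (complexify A - μ • 1) ^ m *ᵥ (E' *ᵥ fun i => (y i : ℂ)) = 0 := by
    intro j
    induction j with
    | zero => exact id
    | succ j ih => exact fun hj => ih (hstep (m + j) (by omega) hj)
  refine hdesc n ?_
  rw [pow_add, mulVec_mulVec, mul_assoc, h'.pow_mul, mul_zero, zero_mulVec]

end Peripheral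

/-! ### The index of the spectral radius, and the second inclusion -/

section Index
open Filter Topology

variable {n : ℕ} {K : PointedCone ℝ (Fin n → ℝ)} {A : Matrix (Fin n) (Fin n) ℝ}

/-- Once two consecutive null spaces agree, all later ones do, and the `n`-th power already kills
the range of `E`. -/
theorem pow_eigenvalueIndex_mul {μ : ℝ} {E J : Matrix (Fin n) (Fin n) ℝ}
    (h : IsSpectralSplitting A μ E J) : (A - μ • 1) ^ eigenvalueIndex A μ * E = 0 := by
  set N := A - μ • (1 : Matrix (Fin n) (Fin n) ℝ) with hN
  have hmem : ∀ k (v : Fin n → ℝ), v ∈ nullSpace (N ^ k) ↔ N ^ k *ᵥ v = 0 := fun k v => by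
    rw [nullSpace, LinearMap.mem_ker, toLin'_apply]
  have hne : {k | nullSpace (N ^ k) = nullSpace (N ^ (k + 1))}.Nonempty := by
    refine ⟨n, le_antisymm (fun v hv => ?_) (fun v hv => ?_)⟩
    · rw [hmem] at hv ⊢
      rw [pow_succ', ← mulVec_mulVec, hv, mulVec_zero]
    · rw [hmem] at hv ⊢
      rw [← h.mulVec_eq_self hv, mulVec_mulVec, h.pow_mul, zero_mulVec]
  have hstab : nullSpace (N ^ eigenvalueIndex A μ) = nullSpace (N ^ (eigenvalueIndex A μ + 1)) :=
    Nat.sInf_mem hne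
  set ν := eigenvalueIndex A μ
  have hdesc : ∀ j (v : Fin n → ℝ), N ^ (ν + j) *ᵥ v = 0 → N ^ ν *ᵥ v = 0 := by
    intro j
    induction j with
    | zero => exact fun v => id
    | succ j ih =>
      intro v hv
      have h1 : N ^ j *ᵥ v ∈ nullSpace (N ^ (ν + 1)) := by
        rw [hmem, mulVec_mulVec, ← pow_add, add_right_comm]; exact hv
      rw [← hstab, hmem, mulVec_mulVec, ← pow_add] at h1
      exact ih v h1
  refine ext_of_mulVec_single fun i => ?_
  rw [zero_mulVec, ← mulVec_mulVec]
  refine hdesc n _ ?_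
  rw [pow_add, mulVec_mulVec, mul_assoc, h.pow_mul, mul_zero, zero_mulVec]

theorem mulVec_eq_zero_of_cone (hK : IsProperCone K) {E : Matrix (Fin n) (Fin n) ℂ}
    (hE : ∀ y ∈ K, E *ᵥ (fun i => (y i : ℂ)) = 0) : E = 0 := by
  have hall : ∀ y : Fin n → ℝ, E *ᵥ (fun i => (y i : ℂ)) = 0 := by
    intro y
    have hy : y ∈ Submodule.span ℝ (K : Set (Fin n → ℝ)) := by
      rw [hK.span_eq_top]; trivial
    induction hy using Submodule.span_induction with
    | mem y hy => exact hE y hy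
    | zero =>
      simp only [Pi.zero_apply, Complex.ofReal_zero]
      exact mulVec_zero E
    | add a b _ _ ha hb =>
      have : (fun i => ((a + b) i : ℂ)) = (fun i => (a i : ℂ)) + fun i => (b i : ℂ) := by
        ext i; simp
      rw [this, mulVec_add, ha, hb, add_zero]
    | smul c a _ ha =>
      have : (fun i => ((c • a) i : ℂ)) = (c : ℂ) • fun i => (a i : ℂ) := by
        ext i; simp
      rw [this, mulVec_smul, ha, smul_zero]
  refine ext_of_mulVec_single fun i => ?_
  rw [zero_mulVec, ← hall (Pi.single i 1)]
  congr 1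
  ext j
  by_cases hij : j = i
  · subst hij; simp
  · simp [Pi.single_eq_of_ne hij]

/-- The spectral radius is an eigenvalue (**Perron--Frobenius**). -/
theorem IsProperCone.one_le_eigenvalueIndex (hn : 1 ≤ n) (hK : IsProperCone K)
    (hA : A ∈ positiveMaps K) : 1 ≤ eigenvalueIndex A (rho A) := by
  by_contra! h0
  obtain ⟨E, J, h⟩ := exists_isSpectralSplitting A (rho A)
  have hE := pow_eigenvalueIndex_mul h
  obtain ⟨μ, v, hμ, hv, hev⟩ := exists_eigenvector_norm_eq_rho hn A
  obtain ⟨E', J', h'⟩ := exists_isSpectralSplitting (complexify A) μ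
  -- Index `0` forces `E = 0`, so the comparison with `m = 0` kills the `μ`-component of every
  -- vector of `K`, and `K` spans.
  have hE' : E' = 0 := mulVec_eq_zero_of_cone hK fun y hy => by
    have := hK.peripheral_pow_mulVec_eq_zero hA h hμ h' hy (m := 0)
    rw [Nat.lt_one_iff.1 h0] at hE
    rw [mulVec_mulVec, hE, zero_mulVec, mulVec_mulVec, pow_zero, one_mul] at this
    exact this rfl
  have := h'.mulVec_eq_self (k := 1) (by rwa [pow_one])
  rw [hE', zero_mulVec] at this
  exact hv this.symm

/-- A vector of the cone orthogonal to all nonnegative eigenvectors of `Aᵀ` for `ρ(A)` has order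
less than the index of `ρ(A)`. -/
theorem IsProperCone.pow_pred_index_mulVec_eq_zero (hn : 1 ≤ n) (hK : IsProperCone K)
    (hA : A ∈ positiveMaps K) {E J : Matrix (Fin n) (Fin n) ℝ}
    (h : IsSpectralSplitting A (rho A) E J) {y : Fin n → ℝ}
    (hy : ∀ z ∈ dualEigenFace K A, z ⬝ᵥ y = 0) :
    (A - rho A • 1) ^ (eigenvalueIndex A (rho A) - 1) *ᵥ (E *ᵥ y) = 0 := by
  have hν := hK.one_le_eigenvalueIndex hn hA
  have hE := pow_eigenvalueIndex_mul h
  set ν := eigenvalueIndex A (rho A)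
  set P := (A - rho A • 1) ^ (ν - 1) * E with hP
  -- `P` is the limit of `(s - ρ)^ν (s - A)⁻¹`, a nonnegative multiple of a map preserving `K`.
  have hpos : ∀ v ∈ K, P *ᵥ v ∈ K := by
    intro v hv
    choose! w hw using fun (s : ℝ) (hs : rho A < s) =>
      (exists_real_resolvent A hs v).imp fun _ h => h.1
    have hreal : Tendsto (fun s : ℝ => s) (𝓝[>] rho A) (𝓝[≠] rho A) :=
      tendsto_id.mono_left (nhdsWithin_mono _ fun s hs => ne_of_gt hs)
    have hlim := h.tendsto_pow_smul hreal (w := w)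
      (by filter_upwards [self_mem_nhdsWithin] with s hs using hw s hs) hν
      (y := v) (by rw [mulVec_mulVec, hE, zero_mulVec])
    rw [mulVec_mulVec] at hlim
    refine hK.isClosed.mem_of_tendsto hlim ?_
    filter_upwards [self_mem_nhdsWithin] with s hs
    have hs' : 0 ≤ s - rho A := (sub_pos.2 hs).le
    exact PointedCone.smul_mem K (by positivity) (hK.resolvent_mem hA hs hv (hw s hs))
  rw [mulVec_mulVec]
  refine hK.eq_zero_of_dual fun z hz => ?_
  have hPA : P * (rho A • 1 - A) = 0 := by
    rw [hP, mul_assoc, ← neg_sub A, mul_neg, (h.commute_sub (rho A)).eq, mul_neg, ← mul_assoc,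
      ← pow_succ, Nat.sub_add_cancel hν, hE, neg_zero]
  rw [dotProduct_mulVec, ← mulVec_transpose]
  -- `Pᵀ z` is itself one of the nonnegative eigenvectors of `Aᵀ`, because `P(ρ - A) = 0` and `P`
  -- preserves `K`.
  refine hy _ (subset_faceGenerated _ ⟨?_, mem_dualCone.2 fun v hv => ?_⟩)
  · rw [SetLike.mem_coe, nullSpace, LinearMap.mem_ker, toLin'_apply, mulVec_mulVec]
    have : rho A • (1 : Matrix (Fin n) (Fin n) ℝ) - Aᵀ = (rho A • 1 - A)ᵀ := by
      rw [transpose_sub, transpose_smul, transpose_one]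
    rw [this, ← transpose_mul, hPA, transpose_zero, zero_mulVec]
  · rw [mulVec_transpose, ← dotProduct_mulVec]
    exact mem_dualCone.1 hz _ (hpos v hv)

theorem spectralPair_le (hn : 1 ≤ n) (hK : IsProperCone K) (hA : A ∈ positiveMaps K)
    {y : Fin n → ℝ} (hyK : y ∈ K) (hy : ∀ z ∈ dualEigenFace K A, z ⬝ᵥ y = 0) :
    spectralPair A y ≤ toLex (rho A, (eigenvalueIndex A (rho A) : ℝ) - 1) := by
  obtain ⟨E, J, h⟩ := exists_isSpectralSplitting A (rho A)
  have hν := hK.one_le_eigenvalueIndex hn hA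
  have hzero := hK.pow_pred_index_mulVec_eq_zero hn hA h hy
  set yc : Fin n → ℂ := fun i => (y i : ℂ) with hyc
  have hdec : IsGenEigenDecomposition (complexify A) yc (genEigenComponents (complexify A) yc) :=
    (existsUnique_genEigenDecomposition (complexify A) yc).choose_spec.1
  set f := genEigenComponents (complexify A) yc with hf
  have hgen : ∀ μ, ∃ k, (complexify A - μ • 1) ^ k *ᵥ f μ = 0 := fun μ => by
    obtain ⟨k, hk⟩ := (Module.End.mem_maxGenEigenspace _ _ _).1 (hdec.1 μ)
    refine ⟨k, ?_⟩
    have hlin : toLin' (complexify A) - μ • 1 = toLin' (complexify A - μ • 1) := by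
      rw [map_sub, map_smul, toLin'_one]; rfl
    rwa [hlin, ← toLin'_pow, toLin'_apply] at hk
  have hcomp : ∀ {μ : ℂ} {E' J' : Matrix (Fin n) (Fin n) ℂ},
      IsSpectralSplitting (complexify A) μ E' J' → E' *ᵥ yc = f μ := by
    intro μ E' J' h'
    rw [← hdec.2, Finsupp.sum, mulVec_sum, Finset.sum_eq_single μ]
    · obtain ⟨k, hk⟩ := hgen μ
      exact h'.mulVec_eq_self hk
    · intro ν _ hνμ
      obtain ⟨k, hk⟩ := hgen ν
      exact h'.mulVec_eq_zero_of_ne hνμ hk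
    · intro hμ
      rw [Finsupp.notMem_support_iff.1 hμ, mulVec_zero]
  have hle : localSpectralRadius (complexify A) yc ≤ rho A := by
    have hρ : 0 ≤ rho A := ENNReal.toReal_nonneg
    rw [localSpectralRadius, ← Real.coe_toNNReal _ hρ, NNReal.coe_le_coe]
    refine Finset.sup_le fun μ hμ => ?_
    obtain ⟨k, hk⟩ := hgen μ
    rw [← NNReal.coe_le_coe, coe_nnnorm, Real.coe_toNNReal _ hρ]
    exact norm_le_rho (Finsupp.mem_support_iff.1 hμ) hk
  rw [spectralPair, Prod.Lex.toLex_le_toLex]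
  rcases hle.lt_or_eq with hlt | heq
  · exact Or.inl hlt
  refine Or.inr ⟨heq, ?_⟩
  have hord : vectorOrder (complexify A) yc ≤ eigenvalueIndex A (rho A) - 1 := by
    refine Finset.sup_le fun μ hμ => ?_
    rw [Finset.mem_filter, heq] at hμ
    obtain ⟨E', J', h'⟩ := exists_isSpectralSplitting (complexify A) μ
    have h1 := hK.peripheral_pow_mulVec_eq_zero hA h hμ.2 h' hyK hzero
    rw [hcomp h'] at h1
    refine Nat.sInf_le ⟨?_, h1⟩
    -- The order is at least `1` by definition; exponent `0` here would make the component itself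
    -- vanish, though `μ` is in the support.
    by_contra hlt
    rw [Nat.lt_one_iff.1 (not_le.1 hlt), pow_zero, one_mulVec] at h1
    exact Finsupp.mem_support_iff.1 hμ.1 h1
  have : ((vectorOrder (complexify A) yc : ℕ) : ℝ) ≤ ((eigenvalueIndex A (rho A) - 1 : ℕ) : ℝ) := by
    exact_mod_cast hord
  rwa [Nat.cast_sub hν, Nat.cast_one] at this

end Index
end ConeEquations

theorem corollary4p8 {n : ℕ} (hn : 1 ≤ n) (K : PointedCone ℝ (Fin n → ℝ))
    (hK : ConeEquations.IsProperCone K) (A : Matrix (Fin n) (Fin n) ℝ)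
    (hA : A ∈ positiveMaps K) :
    faceGenerated K (shiftImage A (K : Set (Fin n → ℝ)) ∩ K) =
        faceGenerated K ((K : Set (Fin n → ℝ)) ∩ shiftImage A (genEigenFace K A)) ∧
      (faceGenerated K ((K : Set (Fin n → ℝ)) ∩ shiftImage A (genEigenFace K A)) :
          Set (Fin n → ℝ)) ⊆
        (genEigenFace K A : Set (Fin n → ℝ)) ∩ dualFace (dualCone K) (dualEigenFace K A) ∧
      (genEigenFace K A : Set (Fin n → ℝ)) ∩ dualFace (dualCone K) (dualEigenFace K A) ⊆
        (genEigenFace K A : Set (Fin n → ℝ)) ∩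
          {y | y ∈ K ∧ spectralPair A y ≤ toLex (rho A, (eigenvalueIndex A (rho A) : ℝ) - 1)} := by
  refine ⟨by rw [shiftImage_inter_eq hK hA], faceGenerated_shiftImage_subset hA, ?_⟩
  rintro y ⟨hyF, hy⟩
  have hyK : y ∈ K := isFaceOf_genEigenFace.le hyF
  exact ⟨hyF, hyK, spectralPair_le hn hK hA hyK fun z hz => hy.1 z (Submodule.subset_span hz)⟩
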